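/- Let $\mathcal H=\{(x,v)\in\mathbb R^2: v\ge 0\}$, and let $d_H$ be the Riemannian distance on $\mathcal H$ generated by the metric form $ds^2=v^{-1}(dx^2+dv^2)$ on the open half-plane $\{v>0\}$; that is, $d_H(p,q)$ is the infimum of the lengths $\int_0^1\sqrt{(\dot x^2+\dot v^2)/v}\,dt$ over all continuous curves $t\mapsto(x(t),v(t))$, $t\in[0,1]$, from $p$ to $q$ that are $C^1$ with $v>0$ on $(0,1)$ (the endpoints may lie on the boundary $v=0$). For $\beta>0$ put $$D_{\beta,0}=\inf_{v\ge 0}\frac{d_H((0,1),(\beta,v))^2}{2},$$ half the squared Heston distance from $(0,1)$ to the vertical line $x=\beta$, and let $$\Lambda(x,\theta)=\frac{\theta^2}{(\theta-\sin\theta)^2}\Big[(\theta-\sin\theta)x+2(1-\cos\theta)-\theta\sin\theta-(1-\cos\theta)\sqrt{2(\theta-\sin\theta)x+2(1-\cos\theta)-\theta^2}\Big],$$ which is defined and real when $\theta\ne0$ and the expression under the square root is nonnegative. Theorem 2.1. If $0<\beta<\frac{\pi}{2}$, then $\Lambda(\beta,\theta)$ is defined and real for all $\theta\in[\frac{\beta}{11},2\beta]$,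 and $$D_{\beta,0}=\min_{\frac{\beta}{11}\le\theta\le 2\beta}\Lambda(\beta,\theta).$$ If $\frac{\pi}{2}\le\beta<\infty$, then $\Lambda(\beta,\theta)$ is defined and real for all $\theta\in[\frac17,\pi]$, and $$D_{\beta,0}=\min_{\frac17\le\theta\le\pi}\Lambda(\beta,\theta).$$ -/

import Mathlib

open Set MeasureTheory

/-- The closed half-plane `{(x, v) : v ≥ 0}`, on whose interior the Heston metric lives. -/
def hestonPlane : Set (ℝ × ℝ) := {p | 0 ≤ p.2}

/-- Length of the tangent vector `w` at the point `p` (with `p.2 > 0`) for the metric form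
`ds² = v⁻¹ (dx² + dv²)`. -/
noncomputable def hestonNorm (p w : ℝ × ℝ) : ℝ :=
  Real.sqrt ((p.2)⁻¹ * (w.1 ^ 2 + w.2 ^ 2))

/-- `t ↦ (x t, v t)`, `t ∈ [0, 1]`, is an admissible curve from `p` to `q`: it is continuous
on `[0, 1]`, has the prescribed endpoints, and on `(0, 1)` it is a `C¹` curve in the open
half-plane. The endpoints are allowed to lie on the boundary `v = 0`. -/
structure IsHestonCurve (p q : ℝ × ℝ) (x v : ℝ → ℝ) : Prop where
  continuousOn_x : ContinuousOn x (Icc 0 1)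
  continuousOn_v : ContinuousOn v (Icc 0 1)
  contDiffOn_x : ContDiffOn ℝ 1 x (Ioo 0 1)
  contDiffOn_v : ContDiffOn ℝ 1 v (Ioo 0 1)
  pos : ∀ t ∈ Ioo (0 : ℝ) 1, 0 < v t
  source : (x 0, v 0) = p
  target : (x 1, v 1) = q

/-- The Riemannian length of the curve `t ↦ (x t, v t)`, `0 < t < 1`. -/
noncomputable def hestonLength (x v : ℝ → ℝ) : ENNReal :=
  ∫⁻ t in Ioo (0 : ℝ) 1, ENNReal.ofReal (hestonNorm (x t, v t) (deriv x t, deriv v t))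

/-- The Heston distance with values in `[0, ∞]`: the infimum of the lengths of the admissible
curves from `p` to `q`. -/
noncomputable def hestonEDist (p q : ℝ × ℝ) : ENNReal :=
  sInf {l | ∃ x v : ℝ → ℝ, IsHestonCurve p q x v ∧ hestonLength x v = l}

/-- The Heston distance is finite from an interior point to any point of the closed
half-plane. -/
theorem hestonEDist_ne_top {p q : ℝ × ℝ} (hp : 0 < p.2) (hq : q ∈ hestonPlane) :
    hestonEDist p q ≠ ⊤ := by
  have hq' : 0 ≤ q.2 := hq
  set a := q.1 - p.1 with ha
  set b := q.2 - p.2 with hb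
  set x : ℝ → ℝ := fun t => p.1 + t * a with hx
  set v : ℝ → ℝ := fun t => p.2 + t * b with hv
  have hcx : ContDiff ℝ 1 x := by fun_prop
  have hcv : ContDiff ℝ 1 v := by fun_prop
  have hlow : ∀ t ∈ Ioo (0 : ℝ) 1, p.2 * (1 - t) ≤ v t := by
    intro t ht
    have : 0 ≤ t * q.2 := mul_nonneg ht.1.le hq'
    simp only [hv, hb]
    nlinarith
  have hcurve : IsHestonCurve p q x v := by
    refine ⟨hcx.continuous.continuousOn, hcv.continuous.continuousOn, hcx.contDiffOn,
      hcv.contDiffOn, fun t ht => ?_, ?_, ?_⟩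
    · exact lt_of_lt_of_le (mul_pos hp (by linarith [ht.2])) (hlow t ht)
    · simp [hx, hv]
    · simp [hx, hv, ha, hb]
  have hdx : ∀ t, deriv x t = a := fun t => by simp [hx]
  have hdv : ∀ t, deriv v t = b := fun t => by simp [hv]
  have hle : hestonEDist p q ≤ hestonLength x v := sInf_le ⟨x, v, hcurve, rfl⟩
  refine ne_top_of_le_ne_top ?_ hle
  set C : ℝ := Real.sqrt ((p.2)⁻¹ * (a ^ 2 + b ^ 2)) with hC
  have hint : IntegrableOn (fun t : ℝ => C * (1 - t) ^ (-(1 / 2) : ℝ)) (Ioo 0 1) := by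
    have h1 : IntervalIntegrable (fun t : ℝ => t ^ (-(1 / 2) : ℝ)) volume 0 1 :=
      intervalIntegral.intervalIntegrable_rpow' (by norm_num)
    have h2 := (h1.comp_sub_left 1).symm
    simp only [sub_zero, sub_self] at h2
    have h3 := (intervalIntegrable_iff_integrableOn_Ioo_of_le zero_le_one).1 h2
    exact h3.const_mul C
  refine ne_top_of_le_ne_top hint.lintegral_lt_top.ne ?_
  refine setLIntegral_mono' measurableSet_Ioo fun t ht => ENNReal.ofReal_le_ofReal ?_
  have h1t : 0 < 1 - t := by linarith [ht.2]
  have hpt : 0 < p.2 * (1 - t) := mul_pos hp h1t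
  rw [hestonNorm, hdx, hdv, Real.rpow_neg h1t.le, ← Real.sqrt_eq_rpow, hC, ← Real.sqrt_inv,
    ← Real.sqrt_mul (by positivity)]
  apply Real.sqrt_le_sqrt
  have h3 : (v t)⁻¹ ≤ (p.2 * (1 - t))⁻¹ := inv_anti₀ hpt (hlow t ht)
  calc (v t)⁻¹ * (a ^ 2 + b ^ 2) ≤ (p.2 * (1 - t))⁻¹ * (a ^ 2 + b ^ 2) := by gcongr
    _ = (p.2)⁻¹ * (a ^ 2 + b ^ 2) * (1 - t)⁻¹ := by rw [mul_inv]; ring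

/-- The (uncorrelated) Heston distance. -/
noncomputable def hestonDist (p q : ℝ × ℝ) : ℝ := (hestonEDist p q).toReal

/-- The line `x = β + γ v` in the closed half-plane. -/
def hestonLine (β γ : ℝ) : Set (ℝ × ℝ) := {p | p ∈ hestonPlane ∧ p.1 = β + γ * p.2}

/-- Half the squared Heston distance from `(0, 1)` to the line `x = β + γ v`. -/
noncomputable def hestonD (β γ : ℝ) : ℝ :=
  sInf ((fun p => hestonDist (0, 1) p ^ 2 / 2) '' hestonLine β γ)

/-- The expression under the square root in `hestonLambda`. -/
noncomputable def hestonRadicand (x θ : ℝ) : ℝ :=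
  2 * (θ - Real.sin θ) * x + 2 * (1 - Real.cos θ) - θ ^ 2

/-- The function `Λ(x, θ)`, meaningful for `θ ≠ 0` and `hestonRadicand x θ ≥ 0`. -/
noncomputable def hestonLambda (x θ : ℝ) : ℝ :=
  θ ^ 2 / (θ - Real.sin θ) ^ 2 *
    ((θ - Real.sin θ) * x + 2 * (1 - Real.cos θ) - θ * Real.sin θ
      - (1 - Real.cos θ) * Real.sqrt (hestonRadicand x θ))

/-!
The geodesics of `v⁻¹ (dx² + dv²)` are the cycloids generated by circles rolling on `v = 0`: an arc
of angle `θ` and radius `r` has length `√(2 r) θ`. The shortest curve from `(0, 1)` to the line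
`x = β` meets the line orthogonally, hence is the cycloid arc whose vertex lies on the line. If its
angle is `ψ`, then `β = (ψ + sin ψ) / (1 + cos ψ)`, `r = 1 / (1 + cos ψ)`, and half its squared
length is `ψ² / (1 + cos ψ)`.

That no curve is shorter is shown by a calibration. The function `lineDist u v`, the length of such
an arc started at height `v` and signed horizontal distance `u` from the line, satisfies the eikonal
equation, so it changes along any curve by at most the length of the curve
(`ofReal_lineDist_le_hestonLength`), and it vanishes on the line, continuously up to the boundary.
Together with the explicit arc this gives `hestonD_eq`.

Among the cycloid arcs of angle `θ` from `(0, 1)` to the line, the radius is a root of a quadratic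
equation, and `Λ(β, θ) = r θ²` for the smaller root `r` (`lineDist_sq_le_hestonLambda`). So
`Λ(β, θ)` is half the squared length of a curve from `(0, 1)` to the line, which gives
`hestonD β 0 ≤ Λ(β, θ)` whenever `0 < θ ≤ min π (2 β)`. At `θ = ψ` there is equality
(`hestonLambda_vertex`), and it remains to locate `ψ` in the stated intervals.
-/

/-! ### The angle of the cycloid that meets a vertical line at its vertex -/

/-- For a cycloid arc ending at the vertex, whose angle from the starting point to the vertex is
`2 * arctan y`, the ratio of the horizontal distance covered to the height of the starting point.
Writing it in terms of `y` instead of the angle makes it an odd increasing bijection of `ℝ`, the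
sign telling on which side of the vertex the arc starts. -/
noncomputable def cycloidRatio (y : ℝ) : ℝ := Real.arctan y * (1 + y ^ 2) + y

theorem mul_arctan_nonneg (y : ℝ) : 0 ≤ y * Real.arctan y := by
  rcases le_total 0 y with h | h
  · exact mul_nonneg h (Real.arctan_nonneg.2 h)
  · exact mul_nonneg_of_nonpos_of_nonpos h (Real.arctan_le_zero.2 h)

theorem hasDerivAt_cycloidRatio (y : ℝ) :
    HasDerivAt cycloidRatio (2 + 2 * (y * Real.arctan y)) y := by
  have h := ((Real.hasDerivAt_arctan y).mul (((hasDerivAt_id y).pow 2).const_add 1)).add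
    (hasDerivAt_id y)
  refine h.congr_deriv ?_
  have : (1 + y ^ 2) ≠ 0 := by positivity
  simp
  field_simp
  ring

theorem strictMono_cycloidRatio : StrictMono cycloidRatio :=
  strictMono_of_deriv_pos fun y => by
    rw [(hasDerivAt_cycloidRatio y).deriv]
    linarith [mul_arctan_nonneg y]

theorem continuous_cycloidRatio : Continuous cycloidRatio :=
  continuous_iff_continuousAt.2 fun y => (hasDerivAt_cycloidRatio y).continuousAt

theorem surjective_cycloidRatio : Function.Surjective cycloidRatio := by
  refine continuous_cycloidRatio.surjective ?_ ?_
  · refine Filter.tendsto_atTop_mono' _ ?_ Filter.tendsto_id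
    filter_upwards [Filter.eventually_ge_atTop 0] with y hy
    have := mul_nonneg (Real.arctan_nonneg.2 hy) (by positivity : 0 ≤ 1 + y ^ 2)
    simp only [cycloidRatio, id]
    linarith
  · refine Filter.tendsto_atBot_mono' _ ?_ Filter.tendsto_id
    filter_upwards [Filter.eventually_le_atBot 0] with y hy
    have := mul_nonpos_of_nonpos_of_nonneg (Real.arctan_le_zero.2 hy)
      (by positivity : 0 ≤ 1 + y ^ 2)
    simp only [cycloidRatio, id]
    linarith

/-- The inverse of `cycloidRatio`: the tangent of half the angle of the cycloid arc that starts
at horizontal distance `r` and height `1` from a vertical line and has its vertex on it. -/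
noncomputable def cycloidTan : ℝ → ℝ :=
  (strictMono_cycloidRatio.orderIsoOfSurjective _ surjective_cycloidRatio).symm

theorem cycloidRatio_cycloidTan (r : ℝ) : cycloidRatio (cycloidTan r) = r :=
  (strictMono_cycloidRatio.orderIsoOfSurjective _ surjective_cycloidRatio).apply_symm_apply r

theorem cycloidTan_zero : cycloidTan 0 = 0 := by
  apply strictMono_cycloidRatio.injective
  rw [cycloidRatio_cycloidTan]
  simp [cycloidRatio]

theorem cycloidTan_pos {r : ℝ} (hr : 0 < r) : 0 < cycloidTan r := by
  rw [← strictMono_cycloidRatio.lt_iff_lt, cycloidRatio_cycloidTan]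
  simpa [cycloidRatio] using hr

theorem hasDerivAt_cycloidTan (r : ℝ) :
    HasDerivAt cycloidTan (2 + 2 * (cycloidTan r * Real.arctan (cycloidTan r)))⁻¹ r :=
  HasDerivAt.of_local_left_inverse (OrderIso.continuous _).continuousAt
    (hasDerivAt_cycloidRatio _) (by linarith [mul_arctan_nonneg (cycloidTan r)])
    (Filter.Eventually.of_forall cycloidRatio_cycloidTan)

/-! ### The signed distance to a vertical line -/

/-- The signed Heston distance to a vertical line from the point at height `v` whose signed
horizontal distance from the line is `u`: the signed length of the cycloid arc from it to the line
that ends at its vertex. -/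
noncomputable def lineDist (u v : ℝ) : ℝ :=
  2 * Real.arctan (cycloidTan (u / v)) * Real.sqrt (1 + cycloidTan (u / v) ^ 2) * Real.sqrt v

theorem lineDist_zero_left (v : ℝ) : lineDist 0 v = 0 := by
  simp [lineDist, cycloidTan_zero]

theorem lineDist_one_pos {b : ℝ} (hb : 0 < b) : 0 < lineDist b 1 := by
  have := Real.arctan_pos.2 (cycloidTan_pos hb)
  rw [lineDist, div_one]
  positivity

/-- Along a curve the signed distance changes at the rate `(cos a * u' - sin a * v') / √v`, where
`tan a = cycloidTan (u / v)`. -/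
theorem HasDerivAt.lineDist {u v : ℝ → ℝ} {u' v' t : ℝ} (hu : HasDerivAt u u' t)
    (hv : HasDerivAt v v' t) (hpos : 0 < v t) :
    HasDerivAt (fun s => lineDist (u s) (v s))
      ((u' - cycloidTan (u t / v t) * v') /
        (Real.sqrt (1 + cycloidTan (u t / v t) ^ 2) * Real.sqrt (v t))) t := by
  have hY := (hasDerivAt_cycloidTan (u t / v t)).comp t (hu.fun_div hv hpos.ne')
  have hk := cycloidRatio_cycloidTan (u t / v t)
  have hA := mul_arctan_nonneg (cycloidTan (u t / v t))
  have h1 : HasDerivAt (fun s => 1 + cycloidTan (u s / v s) ^ 2) _ t := (hY.pow 2).const_add 1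
  have h := ((hY.arctan.const_mul 2).mul (h1.sqrt (by positivity))).mul (hv.sqrt hpos.ne')
  refine h.congr_deriv ?_
  simp only [Function.comp_apply, Pi.mul_apply]
  set y := cycloidTan (u t / v t)
  set A := Real.arctan y
  have hu' : u t = (A * (1 + y ^ 2) + y) * v t := by
    rw [eq_comm, ← eq_div_iff hpos.ne']
    exact hk
  rw [hu']
  have hw := Real.sq_sqrt hpos.le
  have hw0 : 0 < Real.sqrt (v t) := Real.sqrt_pos.2 hpos
  set w := Real.sqrt (v t)
  have hz0 : 0 < Real.sqrt (1 + y ^ 2) := Real.sqrt_pos.2 (by positivity)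
  have hz := Real.sq_sqrt (by positivity : 0 ≤ 1 + y ^ 2)
  set z := Real.sqrt (1 + y ^ 2)
  rw [← hw, ← hz]
  have h2 : 1 + y * A ≠ 0 := by linarith
  have h3 : 2 + 2 * (y * A) ≠ 0 := by linarith
  field_simp
  ring

/-- The eikonal inequality for `lineDist`. -/
theorem abs_lineDist_deriv_le (y u' v' : ℝ) {v : ℝ} (hv : 0 < v) :
    |(u' - y * v') / (Real.sqrt (1 + y ^ 2) * Real.sqrt v)| ≤
      Real.sqrt (v⁻¹ * (u' ^ 2 + v' ^ 2)) := by
  apply Real.abs_le_sqrt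
  rw [div_pow, mul_pow, Real.sq_sqrt hv.le, Real.sq_sqrt (by positivity), div_le_iff₀ (by positivity)]
  have : v⁻¹ * (u' ^ 2 + v' ^ 2) * ((1 + y ^ 2) * v) = (u' ^ 2 + v' ^ 2) * (1 + y ^ 2) := by
    field_simp
  rw [this]
  nlinarith [sq_nonneg (y * u' + v')]

/-- A bound which makes the signed distance to a vertical line tend to `0` on approach to that
line, even at a point of the boundary `v = 0`. -/
theorem abs_lineDist_le (u : ℝ) {v : ℝ} (hv : 0 ≤ v) :
    |lineDist u v| ≤ Real.sqrt (2 * Real.pi * |u|) := by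
  apply Real.abs_le_sqrt
  rcases hv.eq_or_lt with rfl | hv
  · simp [lineDist]
    positivity
  have hk := cycloidRatio_cycloidTan (u / v)
  rw [lineDist, mul_pow, mul_pow, Real.sq_sqrt hv.le, Real.sq_sqrt (by positivity)]
  have hA := mul_arctan_nonneg (cycloidTan (u / v))
  have hpi : |Real.arctan (cycloidTan (u / v))| ≤ Real.pi / 2 :=
    abs_le.2 ⟨(Real.neg_pi_div_two_lt_arctan _).le, (Real.arctan_lt_pi_div_two _).le⟩
  set y := cycloidTan (u / v)
  set A := Real.arctan y
  have hu : A * u = (A ^ 2 * (1 + y ^ 2) + y * A) * v := by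
    have : u = cycloidRatio y * v := by rw [hk, div_mul_cancel₀ _ hv.ne']
    rw [this, cycloidRatio]
    ring
  have h1 : A * u ≤ Real.pi / 2 * |u| := by
    calc A * u ≤ |A * u| := le_abs_self _
      _ = |A| * |u| := abs_mul _ _
      _ ≤ _ := by gcongr
  have h2 : 0 ≤ y * A * v := mul_nonneg hA hv.le
  nlinarith

/-! ### The distance to a vertical line -/

/-- By the eikonal inequality, no curve from `(0, 1)` to the line `x = β` is shorter than
`lineDist β 1`. -/
theorem ofReal_lineDist_le_hestonLength {β w : ℝ} {x v : ℝ → ℝ}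
    (h : IsHestonCurve (0, 1) (β, w) x v) :
    ENNReal.ofReal (lineDist β 1) ≤ hestonLength x v := by
  by_cases htop : hestonLength x v = ⊤
  · simp [htop]
  have hx0 : x 0 = 0 := congrArg Prod.fst h.source
  have hv0 : v 0 = 1 := congrArg Prod.snd h.source
  have hx1 : x 1 = β := congrArg Prod.fst h.target
  have hv_nonneg : ∀ t ∈ Icc (0 : ℝ) 1, 0 ≤ v t := by
    intro t ht
    have hcl : closure (Ioo (0 : ℝ) 1) = Icc 0 1 := closure_Ioo zero_ne_one
    rw [← hcl] at ht
    have := h.continuousOn_v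
    rw [← hcl] at this
    exact le_on_closure (fun s hs => (h.pos s hs).le) continuousOn_const this ht
  set f : ℝ → ℝ := fun t => lineDist (β - x t) (v t) with hf
  have hderiv : ∀ t ∈ Ioo (0 : ℝ) 1, HasDerivAt f (deriv f t) t ∧
      |deriv f t| ≤ hestonNorm (x t, v t) (deriv x t, deriv v t) := by
    intro t ht
    have hnhds := isOpen_Ioo.mem_nhds ht
    have hdx := ((h.contDiffOn_x.contDiffAt hnhds).differentiableAt one_ne_zero).hasDerivAt
    have hdv := ((h.contDiffOn_v.contDiffAt hnhds).differentiableAt one_ne_zero).hasDerivAt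
    have hd := (hdx.const_sub β).lineDist hdv (h.pos t ht)
    refine ⟨hd.differentiableAt.hasDerivAt, ?_⟩
    rw [hd.deriv]
    refine (abs_lineDist_deriv_le _ _ _ (h.pos t ht)).trans_eq ?_
    simp [hestonNorm]
  have hcont : ContinuousOn f (Icc 0 1) := by
    intro t ht
    rcases ht.2.eq_or_lt with rfl | ht1
    · -- The height of the end point may be `0`, so only the bound by `√|u|` is available here.
      have hf1 : f 1 = 0 := by simp only [hf, hx1, sub_self, lineDist_zero_left]
      rw [ContinuousWithinAt, hf1]
      refine squeeze_zero_norm' (a := fun t => Real.sqrt (2 * Real.pi * |β - x t|)) ?_ ?_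
      · filter_upwards [self_mem_nhdsWithin] with s hs
        exact abs_lineDist_le _ (hv_nonneg s hs)
      · have hc : ContinuousOn (fun t => Real.sqrt (2 * Real.pi * |β - x t|)) (Icc 0 1) :=
          (continuousOn_const.mul (continuousOn_const.sub h.continuousOn_x).abs).sqrt
        have := hc 1 ht
        rw [ContinuousWithinAt] at this
        simpa [hx1] using this
    · have hvt : v t ≠ 0 := by
        rcases ht.1.eq_or_lt with rfl | ht0
        · simp [hv0]
        · exact (h.pos t ⟨ht0, ht1⟩).ne'
      have hY : ContinuousWithinAt (fun s => cycloidTan ((β - x s) / v s)) (Icc 0 1) t :=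
        (hasDerivAt_cycloidTan _).continuousAt.comp_continuousWithinAt
          ((continuousWithinAt_const.sub (h.continuousOn_x t ht)).div (h.continuousOn_v t ht) hvt)
      have hA := Real.continuous_arctan.continuousAt.comp_continuousWithinAt hY
      exact ((continuousWithinAt_const.mul hA).mul
        (continuousWithinAt_const.add (hY.pow 2)).sqrt).mul (h.continuousOn_v t ht).sqrt
  have hlint : ∫⁻ t in Ioo (0 : ℝ) 1, ‖deriv f t‖ₑ ≤ hestonLength x v := by
    refine setLIntegral_mono' measurableSet_Ioo fun t ht => ?_
    rw [Real.enorm_eq_ofReal_abs]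
    exact ENNReal.ofReal_le_ofReal (hderiv t ht).2
  have hint : IntervalIntegrable (deriv f) volume 0 1 := by
    rw [intervalIntegrable_iff_integrableOn_Ioo_of_le zero_le_one]
    exact ⟨(measurable_deriv f).aestronglyMeasurable, hlint.trans_lt (lt_top_iff_ne_top.2 htop)⟩
  have hftc := intervalIntegral.integral_eq_sub_of_hasDerivAt_of_le zero_le_one hcont
    (fun t ht => (hderiv t ht).1) hint
  have hf0 : f 0 = lineDist β 1 := by simp [hf, hx0, hv0]
  have hf1 : f 1 = 0 := by simp only [hf, hx1, sub_self, lineDist_zero_left]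
  rw [intervalIntegral.integral_of_le zero_le_one, integral_Ioc_eq_integral_Ioo, hf0, hf1,
    zero_sub] at hftc
  refine le_trans ?_ hlint
  refine le_trans ?_ (enorm_integral_le_lintegral_enorm _)
  rw [hftc, Real.enorm_eq_ofReal_abs, abs_neg]
  exact ENNReal.ofReal_le_ofReal (le_abs_self _)

theorem lineDist_le_hestonDist {β w : ℝ} (hw : 0 ≤ w) :
    lineDist β 1 ≤ hestonDist (0, 1) (β, w) := by
  refine (ENNReal.ofReal_le_iff_le_toReal
    (hestonEDist_ne_top (by norm_num) (show (β, w) ∈ hestonPlane from hw))).1 ?_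
  refine le_sInf ?_
  rintro _ ⟨x, v, h, rfl⟩
  exact ofReal_lineDist_le_hestonLength h

/-- With `ψ = 2 * arctan (cycloidTan β)`, an arc of angle `ψ` of the cycloid generated by a circle
of radius `1 / (1 + cos ψ)` runs from `(0, 1)` to its vertex on the line `x = β`. -/
theorem exists_vertex_angle {β : ℝ} (hβ : 0 < β) :
    ∃ ψ : ℝ, 0 < ψ ∧ ψ < Real.pi ∧ β * (1 + Real.cos ψ) = ψ + Real.sin ψ ∧
      lineDist β 1 ^ 2 / 2 = ψ ^ 2 / (1 + Real.cos ψ) := by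
  have hy := cycloidTan_pos hβ
  have hk := cycloidRatio_cycloidTan β
  set y := cycloidTan β with hy'
  refine ⟨2 * Real.arctan y, by linarith [Real.arctan_pos.2 hy],
    by linarith [Real.arctan_lt_pi_div_two y], ?_, ?_⟩
  · rw [Real.sin_two_mul, Real.cos_two_mul, Real.sin_arctan, Real.cos_arctan, ← hk, cycloidRatio]
    have := Real.sq_sqrt (by positivity : 0 ≤ 1 + y ^ 2)
    have h0 : 0 < Real.sqrt (1 + y ^ 2) := Real.sqrt_pos.2 (by positivity)
    set z := Real.sqrt (1 + y ^ 2)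
    rw [← this]
    field_simp
    ring
  · rw [Real.cos_two_mul, Real.cos_sq_arctan, lineDist, div_one, ← hy', Real.sqrt_one, mul_one,
      mul_pow, Real.sq_sqrt (by positivity)]
    have h0 : 1 + y ^ 2 ≠ 0 := by positivity
    field_simp
    ring

/-- The arc from `(0, 1)` of a cycloid with vertex on the line `x = β` realizes the bound
`lineDist β 1`. -/
theorem exists_hestonDist_le_lineDist {β : ℝ} (hβ : 0 < β) :
    ∃ w : ℝ, 0 ≤ w ∧ hestonDist (0, 1) (β, w) ≤ lineDist β 1 := by
  obtain ⟨ψ, hψ0, hψpi, hβψ, hD⟩ := exists_vertex_angle hβ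
  have hcos : ∀ t ∈ Icc (0 : ℝ) 1, 0 < 1 + Real.cos (ψ * (1 - t)) := by
    intro t ht
    have h1 : -1 < Real.cos (ψ * (1 - t)) := by
      rw [← Real.cos_pi]
      refine Real.cos_lt_cos_of_nonneg_of_le_pi (mul_nonneg hψ0.le (by linarith [ht.2])) le_rfl ?_
      nlinarith [ht.1]
    linarith
  have hc : 0 < 1 + Real.cos ψ := by simpa using hcos 0 (by simp)
  set r := (1 + Real.cos ψ)⁻¹ with hr
  have hr0 : 0 < r := inv_pos.2 hc
  set x : ℝ → ℝ := fun t => β - r * (ψ * (1 - t) + Real.sin (ψ * (1 - t))) with hx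
  set v : ℝ → ℝ := fun t => r * (1 + Real.cos (ψ * (1 - t))) with hv
  have hdφ : ∀ t : ℝ, HasDerivAt (fun t => ψ * (1 - t)) (-ψ) t := fun t => by
    simpa using ((hasDerivAt_id t).const_sub 1).const_mul ψ
  have hdx : ∀ t, deriv x t = r * ψ * (1 + Real.cos (ψ * (1 - t))) := fun t => by
    rw [((((hdφ t).fun_add (hdφ t).sin).const_mul r).const_sub β).deriv]
    ring
  have hdv : ∀ t, deriv v t = r * ψ * Real.sin (ψ * (1 - t)) := fun t => by
    rw [(((hdφ t).cos.const_add 1).const_mul r).deriv]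
    ring
  have hcx : ContDiff ℝ 1 x := by fun_prop
  have hcv : ContDiff ℝ 1 v := by fun_prop
  have hcurve : IsHestonCurve (0, 1) (β, 2 * r) x v := by
    refine ⟨hcx.continuous.continuousOn, hcv.continuous.continuousOn, hcx.contDiffOn,
      hcv.contDiffOn, fun t ht => mul_pos hr0 (hcos t (Ioo_subset_Icc_self ht)), ?_, ?_⟩
    · simp only [hx, hv, sub_zero, mul_one, ← hβψ, hr, Prod.mk.injEq]
      constructor <;> field_simp
      ring
    · simp [hx, hv, mul_comm, one_add_one_eq_two]
  have hnorm : ∀ t ∈ Ioo (0 : ℝ) 1,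
      ENNReal.ofReal (hestonNorm (x t, v t) (deriv x t, deriv v t)) =
        ENNReal.ofReal (lineDist β 1) := by
    intro t ht
    have h1 := hcos t (Ioo_subset_Icc_self ht)
    congr 1
    rw [hestonNorm, Real.sqrt_eq_iff_mul_self_eq_of_pos (lineDist_one_pos hβ)]
    rw [← sq, (div_eq_iff two_ne_zero).1 hD, hdx, hdv, eq_inv_mul_iff_mul_eq₀
      (mul_pos hr0 h1).ne', div_eq_mul_inv, ← hr]
    have h2 := Real.sin_sq_add_cos_sq (ψ * (1 - t))
    simp only
    linear_combination (-r ^ 2 * ψ ^ 2) * h2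
  refine ⟨2 * r, by positivity, ENNReal.toReal_le_of_le_ofReal (lineDist_one_pos hβ).le ?_⟩
  have hle : hestonEDist (0, 1) (β, 2 * r) ≤ hestonLength x v := sInf_le ⟨x, v, hcurve, rfl⟩
  refine hle.trans_eq ?_
  rw [hestonLength, setLIntegral_congr_fun measurableSet_Ioo hnorm]
  simp

theorem hestonD_eq {β : ℝ} (hβ : 0 < β) : hestonD β 0 = lineDist β 1 ^ 2 / 2 := by
  have h0 := (lineDist_one_pos hβ).le
  obtain ⟨w, hw, hle⟩ := exists_hestonDist_le_lineDist hβ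
  refine IsLeast.csInf_eq ⟨⟨(β, w), ⟨hw, by simp⟩, ?_⟩, ?_⟩
  · simp only [hle.antisymm (lineDist_le_hestonDist hw)]
  · rintro _ ⟨⟨b, w⟩, ⟨hw, hb⟩, rfl⟩
    obtain rfl : b = β := by simpa using hb
    have := lineDist_le_hestonDist (β := b) hw
    simp only
    gcongr

/-! ### Cycloid arcs ending on the line -/

/-- A cycloid arc of angle `θ` and radius `r` from `(0, 1)` to the line `x = β` has length
`√(2 * r) * θ`, which therefore bounds the distance to the line. The arc may pass through a cusp on
the boundary `v = 0`. -/
theorem lineDist_le_of_cycloid {β r θ φ : ℝ} (hr : 0 < r) (hθ : 0 ≤ θ)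
    (hv : r * (1 - Real.cos φ) = 1)
    (hx : r * (θ - Real.sin (φ + θ) + Real.sin φ) = β) :
    lineDist β 1 ≤ Real.sqrt (2 * r) * θ := by
  -- Lifting the arc by `ε` shortens it and keeps it away from the boundary.
  have key : ∀ ε : ℝ, 0 < ε → lineDist β (1 + ε) ≤ Real.sqrt (2 * r) * θ := by
    intro ε hε
    set u : ℝ → ℝ := fun t => β - r * (θ * t - Real.sin (φ + θ * t) + Real.sin φ) with hu
    set v : ℝ → ℝ := fun t => r * (1 - Real.cos (φ + θ * t)) + ε with hv'
    have hvr : ∀ t, r * (1 - Real.cos (φ + θ * t)) ≤ v t := fun t => by simp [hv', hε.le]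
    have hpos : ∀ t, 0 < v t := fun t => by
      have := mul_nonneg hr.le (sub_nonneg.2 (Real.cos_le_one (φ + θ * t)))
      simp only [hv']
      linarith
    have hdθ : ∀ t : ℝ, HasDerivAt (fun t => θ * t) θ t := fun t => by
      simpa using (hasDerivAt_id t).const_mul θ
    have hdu : ∀ t, HasDerivAt u (-(r * (θ - Real.cos (φ + θ * t) * θ))) t := fun t =>
      ((((hdθ t).fun_sub ((hdθ t).const_add φ).sin).add_const (Real.sin φ)).const_mul r).const_sub β
    have hdv : ∀ t, HasDerivAt v (r * -(-Real.sin (φ + θ * t) * θ)) t := fun t =>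
      ((((hdθ t).const_add φ).cos.const_sub 1).const_mul r).add_const ε
    have h := norm_image_sub_le_of_norm_deriv_le_segment_01' (C := Real.sqrt (2 * r) * θ)
      (fun t _ => ((hdu t).lineDist (hdv t) (hpos t)).hasDerivWithinAt) (fun t _ => by
        refine (abs_lineDist_deriv_le _ _ _ (hpos t)).trans (Real.sqrt_le_iff.2 ⟨by positivity, ?_⟩)
        rw [mul_pow (Real.sqrt _), Real.sq_sqrt (by positivity), inv_mul_le_iff₀ (hpos t)]
        have h1 := mul_le_mul_of_nonneg_left (hvr t) (by positivity : 0 ≤ 2 * r * θ ^ 2)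
        have h2 := Real.sin_sq_add_cos_sq (φ + θ * t)
        refine le_trans (le_of_eq ?_) (h1.trans_eq (by ring))
        linear_combination (r ^ 2 * θ ^ 2) * h2)
    have hu1 : u 1 = 0 := by simp [hu, hx]
    have hu0 : u 0 = β := by simp [hu]
    have hv0 : v 0 = 1 + ε := by simp [hv', hv]
    rw [hu1, hu0, hv0, lineDist_zero_left, zero_sub, norm_neg] at h
    exact (le_abs_self _).trans h
  have hcont : ContinuousAt (fun v => lineDist β v) 1 :=
    ((hasDerivAt_const (1 : ℝ) β).lineDist (hasDerivAt_id 1) one_pos).continuousAt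
  have hlim : Filter.Tendsto (fun ε : ℝ => lineDist β (1 + ε)) (nhdsWithin 0 (Ioi 0))
      (nhds (lineDist β 1)) := by
    have h1 : Filter.Tendsto (fun ε : ℝ => 1 + ε) (nhdsWithin 0 (Ioi 0)) (nhds 1) := by
      have : Continuous fun ε : ℝ => 1 + ε := by fun_prop
      simpa using (this.tendsto 0).mono_left nhdsWithin_le_nhds
    exact hcont.tendsto.comp h1
  exact le_of_tendsto hlim (by filter_upwards [self_mem_nhdsWithin] with ε hε using key ε hε)

/-! ### The function `Λ` -/

theorem mul_sin_le_two_mul_one_sub_cos {θ : ℝ} (h0 : 0 < θ) (hpi : θ ≤ Real.pi) :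
    θ * Real.sin θ ≤ 2 * (1 - Real.cos θ) := by
  have hs : 0 ≤ Real.sin (θ / 2) := Real.sin_nonneg_of_nonneg_of_le_pi (by linarith) (by linarith)
  have h1 : θ / 2 * Real.cos (θ / 2) ≤ Real.sin (θ / 2) := by
    rcases hpi.eq_or_lt with rfl | hlt
    · simp
    · have hc : 0 < Real.cos (θ / 2) := Real.cos_pos_of_mem_Ioo ⟨by linarith, by linarith⟩
      have := Real.lt_tan (by linarith : 0 < θ / 2) (by linarith)
      rw [Real.tan_eq_sin_div_cos, lt_div_iff₀ hc] at this
      exact this.le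
  have h2 : Real.sin θ = 2 * Real.sin (θ / 2) * Real.cos (θ / 2) := by
    rw [← Real.sin_two_mul]; ring_nf
  have h3 : Real.cos θ = 1 - 2 * Real.sin (θ / 2) ^ 2 := by
    have := Real.cos_two_mul (θ / 2)
    rw [mul_div_cancel₀ θ two_ne_zero, Real.cos_sq'] at this
    linarith
  rw [h2, h3]
  nlinarith [mul_le_mul_of_nonneg_left h1 hs]

theorem hestonRadicand_nonneg {β θ : ℝ} (h0 : 0 < θ) (hpi : θ ≤ Real.pi) (hβ : θ ≤ 2 * β) :
    0 ≤ hestonRadicand β θ := by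
  have h1 := mul_sin_le_two_mul_one_sub_cos h0 hpi
  have h2 := mul_le_mul_of_nonneg_left hβ (sub_nonneg.2 (Real.sin_le h0.le))
  rw [hestonRadicand]
  linarith

/-- `Λ(β, θ)` is `r * θ ^ 2`, where `r` is the smaller of the radii of the cycloid arcs of angle
`θ` from `(0, 1)` to the line `x = β`, so that it is half the square of a length. -/
theorem lineDist_sq_le_hestonLambda {β θ : ℝ} (hβ : 0 < β) (h0 : 0 < θ) (hpi : θ ≤ Real.pi)
    (hθβ : θ ≤ 2 * β) : lineDist β 1 ^ 2 / 2 ≤ hestonLambda β θ := by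
  have hR := Real.sq_sqrt (hestonRadicand_nonneg h0 hpi hθβ)
  have hRdef : hestonRadicand β θ =
    2 * (θ - Real.sin θ) * β + 2 * (1 - Real.cos θ) - θ ^ 2 := rfl
  rw [hRdef] at hR
  have hK : 0 < θ - Real.sin θ := sub_pos.2 (Real.sin_lt h0)
  have hc : 0 < 1 - Real.cos θ := by
    rw [sub_pos, ← Real.cos_zero]
    exact Real.cos_lt_cos_of_nonneg_of_le_pi le_rfl hpi h0
  have hB : 0 < (θ - Real.sin θ) * β + 2 * (1 - Real.cos θ) - θ * Real.sin θ := by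
    have := mul_pos hK hβ
    linarith [mul_sin_le_two_mul_one_sub_cos h0 hpi]
  have hsc := Real.sin_sq_add_cos_sq θ
  rw [hestonLambda, hRdef]
  set q := Real.sqrt (2 * (θ - Real.sin θ) * β + 2 * (1 - Real.cos θ) - θ ^ 2)
  set s := Real.sin θ with hs
  set c := Real.cos θ with hc'
  set B := (θ - s) * β + 2 * (1 - c) - θ * s with hBdef
  have hB0 : B = (β - s) * (θ - s) + (1 - c) ^ 2 := by
    rw [hBdef]
    linear_combination -hsc
  -- The radii are the roots of `(θ - s)² r² - 2 B r + ((β - s)² + (1 - c)²) = 0`.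
  have hdisc : B ^ 2 - (1 - c) ^ 2 * q ^ 2 = (θ - s) ^ 2 * ((β - s) ^ 2 + (1 - c) ^ 2) := by
    rw [hR, hB0]
    linear_combination (1 - c) ^ 2 * hsc
  set r := (B - (1 - c) * q) / (θ - s) ^ 2 with hr
  have hrK : r * (θ - s) ^ 2 = B - (1 - c) * q := div_mul_cancel₀ _ (by positivity)
  have hr0 : 0 < r := by
    refine div_pos (sub_pos.2 (lt_of_pow_lt_pow_left₀ 2 hB.le ?_)) (by positivity)
    have : 0 < (θ - s) ^ 2 * ((β - s) ^ 2 + (1 - c) ^ 2) := by positivity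
    nlinarith
  have hroot : (β - r * θ + (r - 1) * s) ^ 2 = (2 * r - 1) * (1 - c) ^ 2 := by
    have hK2 : (θ - s) ^ 2 ≠ 0 := by positivity
    refine mul_left_cancel₀ hK2 ?_
    linear_combination (r * (θ - s) ^ 2 + (B - (1 - c) * q)
      - 2 * ((β - s) * (θ - s) + (1 - c) ^ 2)) * hrK - hdisc + 2 * (B - (1 - c) * q) * hB0
  set Y := (β - r * θ + (r - 1) * s) / (1 - c) with hY
  have hYc : Y * (1 - c) = β - r * θ + (r - 1) * s := div_mul_cancel₀ _ hc.ne'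
  have hYsq : Y ^ 2 = 2 * r - 1 := by
    rw [hY, div_pow, hroot, mul_div_cancel_right₀ _ (by positivity)]
  have hnorm : ‖(⟨r - 1, Y⟩ : ℂ)‖ = r := by
    rw [Complex.norm_eq_sqrt_sq_add_sq, Real.sqrt_eq_iff_mul_self_eq_of_pos hr0, hYsq]
    ring
  obtain ⟨φ, hcos, hsin⟩ : ∃ φ : ℝ, r * Real.cos φ = r - 1 ∧ r * Real.sin φ = Y :=
    ⟨Complex.arg ⟨r - 1, Y⟩,
      by simpa only [hnorm] using Complex.norm_mul_cos_arg ⟨r - 1, Y⟩,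
      by simpa only [hnorm] using Complex.norm_mul_sin_arg ⟨r - 1, Y⟩⟩
  have hle := lineDist_le_of_cycloid (β := β) (φ := φ) hr0 h0.le (by linarith) (by
    rw [Real.sin_add, ← hs, ← hc']
    linear_combination hYc + (1 - c) * hsin - s * hcos)
  have hsq : lineDist β 1 ^ 2 ≤ 2 * r * θ ^ 2 := by
    refine (pow_le_pow_left₀ (lineDist_one_pos hβ).le hle 2).trans_eq ?_
    rw [mul_pow, Real.sq_sqrt (by positivity)]
  have : θ ^ 2 / (θ - s) ^ 2 * (B - (1 - c) * q) = r * θ ^ 2 := by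
    rw [hr]; ring
  rw [this]
  linarith

/-- At the angle of the arc with vertex on the line, the radicand is a perfect square. -/
theorem hestonLambda_vertex {β ψ : ℝ} (h0 : 0 < ψ) (hpi : ψ < Real.pi)
    (hβ : β * (1 + Real.cos ψ) = ψ + Real.sin ψ) :
    hestonLambda β ψ = ψ ^ 2 / (1 + Real.cos ψ) := by
  have hsin : 0 < Real.sin ψ := Real.sin_pos_of_pos_of_lt_pi h0 hpi
  have hK : 0 < ψ - Real.sin ψ := sub_pos.2 (Real.sin_lt h0)
  have hc : 0 < 1 + Real.cos ψ := by
    have := Real.cos_lt_cos_of_nonneg_of_le_pi h0.le le_rfl hpi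
    rw [Real.cos_pi] at this
    linarith
  have hsc := Real.sin_sq_add_cos_sq ψ
  have hβ' : β = (ψ + Real.sin ψ) / (1 + Real.cos ψ) := by rw [← hβ, mul_div_cancel_right₀ _ hc.ne']
  have hsqrt : Real.sqrt (hestonRadicand β ψ) = ψ * Real.sin ψ / (1 + Real.cos ψ) := by
    rw [Real.sqrt_eq_iff_mul_self_eq_of_pos (by positivity), hestonRadicand, hβ']
    field_simp
    linear_combination (ψ ^ 2 + 2 + 2 * Real.cos ψ) * hsc
  rw [hestonLambda, hsqrt, hβ']
  field_simp
  linear_combination -2 * hsc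

/-- Since `Λ(β, ·)` takes the value `hestonD β 0` at the angle of the arc with vertex on the line,
it is enough that the interval contains this angle. -/
theorem isLeast_hestonLambda {β a b : ℝ} (hβ : 0 < β) (ha : 0 < a) (hb : b ≤ Real.pi)
    (hb' : b ≤ 2 * β)
    (hmem : ∀ ψ, 0 < ψ → ψ < Real.pi → β * (1 + Real.cos ψ) = ψ + Real.sin ψ → ψ ∈ Icc a b) :
    (∀ θ ∈ Icc a b, 0 ≤ hestonRadicand β θ) ∧
      IsLeast (hestonLambda β '' Icc a b) (hestonD β 0) := by
  refine ⟨fun θ hθ => hestonRadicand_nonneg (ha.trans_le hθ.1) (hθ.2.trans hb) (hθ.2.trans hb'),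
    ?_, ?_⟩
  · obtain ⟨ψ, h0, hpi, hψ, hD⟩ := exists_vertex_angle hβ
    exact ⟨ψ, hmem ψ h0 hpi hψ, by rw [hestonLambda_vertex h0 hpi hψ, hestonD_eq hβ, hD]⟩
  · rintro _ ⟨θ, hθ, rfl⟩
    rw [hestonD_eq hβ]
    exact lineDist_sq_le_hestonLambda hβ (ha.trans_le hθ.1) (hθ.2.trans hb) (hθ.2.trans hb')

theorem theorem2p1 (β : ℝ) :
    (0 < β → β < Real.pi / 2 →
      (∀ θ ∈ Set.Icc (β / 11) (2 * β), 0 ≤ hestonRadicand β θ) ∧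
      IsLeast (hestonLambda β '' Set.Icc (β / 11) (2 * β)) (hestonD β 0)) ∧
    (Real.pi / 2 ≤ β →
      (∀ θ ∈ Set.Icc (1 / 7) Real.pi, 0 ≤ hestonRadicand β θ) ∧
      IsLeast (hestonLambda β '' Set.Icc (1 / 7) Real.pi) (hestonD β 0)) := by
  constructor
  · intro hβ hβpi
    refine isLeast_hestonLambda hβ (by positivity) (by linarith) le_rfl fun ψ h0 hpi hψ => ?_
    have hsin := Real.sin_pos_of_pos_of_lt_pi h0 hpi
    -- As `β < π / 2`, the angle is acute, so that `β ≤ ψ + sin ψ ≤ 2 ψ`.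
    have hψ2 : ψ < Real.pi / 2 := by
      by_contra! hge
      have := Real.cos_nonpos_of_pi_div_two_le_of_le hge (by linarith)
      nlinarith
    have hcos : 0 ≤ Real.cos ψ := Real.cos_nonneg_of_neg_pi_div_two_le_of_le (by linarith) hψ2.le
    constructor
    · nlinarith [Real.sin_le h0.le]
    · nlinarith [Real.cos_le_one ψ]
  · intro hβ
    have hβ0 : 0 < β := by linarith [Real.pi_pos]
    refine isLeast_hestonLambda hβ0 (by norm_num) le_rfl (by linarith) fun ψ h0 hpi hψ =>
      ⟨?_, hpi.le⟩
    by_contra! hlt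
    have hcos : 0 ≤ Real.cos ψ :=
      Real.cos_nonneg_of_neg_pi_div_two_le_of_le (by linarith) (by linarith [Real.pi_gt_three])
    nlinarith [Real.sin_le h0.le, Real.pi_gt_three]
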